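/- **Setting.** For $L>0$ let $\mathcal T_L=[0,L]^3$ be the periodic torus, and let $H_L$ be the space of mean-zero, (distributionally) divergence-free vector fields $u\in L^2(\mathcal T_L;\mathbb R^3)$ with $|u|_{H_L}^2=L^{-3}\int_{\mathcal T_L}\|u\|^2dx$. Let $D(A_L)=H_L\cap H^2$ be the domain of the Stokes operator $A_L=-\Delta$, and write $u(x)=\sum_k\hat u(k)e^{-ik\cdot x}$, $k=\frac{2\pi}{L}m$, $m\in\mathbb Z^3\setminus\{0\}$. Let $\mathcal P_L$ be the set of probability measures $\mu$ on $H_L$ with $\mu(D(A_L))=1$ and $\mu[\int\|Du\|^2dx]<\infty$ that are invariant under translations and discretely isotropic: $u(R\,\cdot)$ and $Ru(\cdot)$ have the same law for every rotation $R$ that maps the set of coordinate axes to itself. Let $\sigma_m$ $(m\in\mathbb Z^3\setminus\{0\})$ be complex $3\times3$ matrices with $m\cdot\sigma_m=0$, $\overline{\sigma_m}=\sigma_{-m}$, $|\sigma_{Rm}|=|\sigma_m|$ (Hilbert–Schmidt norm) for all such $R$, $\sum|\sigma_m|^2<\infty$ and $\sum|m|^2|\sigma_m|^2<\infty$. Let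 $\beta_m$ be standard three-dimensional complex Brownian motions ($E|\beta_m^j(t)|^2=t$) with $\beta_{-m}=\overline{\beta_m}$ and otherwise independent. For $\nu,L>0$ and $n\in\mathbb N$ consider the Galerkin approximation, on the modes $k=\frac{2\pi}{L}m$ with $0<|m|\le n$, of the stochastic Navier–Stokes equations on $\mathcal T_L$, $$du+[\nu A_Lu+\pi^{(n)}_LB_L(u,u)]\,dt=\sum_{0<|m|\le n}\sigma_m\,d\beta_m\,e^{-i\frac{2\pi}{L}m\cdot x},$$ where $B_L(u,u)$ is the divergence-free part of $(u\cdot\nabla)u$ and $\pi_L^{(n)}$ is the orthogonal projection onto these modes. Let $\mathcal S^n(\nu,L)$ be the set of its invariant measures that belong to $\mathcal P_L$, and let $\mathcal P^G_{NS}(\nu,L)$ be the set of all probability measures on $H_L$ that are weak limits of some $\mu_j\in\mathcal S^{k_j}(\nu,L)$ with $k_j\to\infty$. Put $$\mathcal P^G_{NS}=\{(\mu,\nu):\mu\in\mathcal P^G_{NS}(\nu,1)\},\qquad \tilde{\mathcal P}^G_{NS}=\{(\mu,\tilde\nu,L):\mu\in\mathcal P^G_{NS}(\tilde\nu,L)\}.$$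 Fix a coordinate unit vector $e$ and let $S_2^\mu(r)=\mu[\|u(re)-u(0)\|^2]\in[0,\infty]$, where $u$ is evaluated through its continuous representative. **K41 scaling law.** A set $\mathcal M$ of pairs $(\mu,\nu)$ has a scaling law of K41 type if there are $\nu_0>0$, $C>c>0$, $C_0>0$ and a monotone function $R_0:(0,\nu_0]\to\mathbb R_+$ with $R_0>C_0$ and $R_0(\nu)\to\infty$ as $\nu\to0$ such that $c\,r^{2/3}\le S_2^\mu(r)\le C\,r^{2/3}$ for all $(\mu,\nu)\in\mathcal M$ with $\nu\in(0,\nu_0]$ and all $r$ with $C_0\nu^{3/4}<r<\nu^{3/4}R_0(\nu)$. **Condition A.** A set $\tilde{\mathcal M}$ of triples $(\mu,\tilde\nu,L)$ satisfies Condition A if there are $C>c>0$ and an admissible region $$D=\{(\tilde\nu,L):0<\tilde\nu<\tilde\nu_0,\ L>\tilde R_0(\tilde\nu)\},$$ where $\tilde\nu_0>0$ and $\tilde R_0:(0,\tilde\nu_0]\to[1,\infty)$ is strictly decreasing with $\tilde R_0(\tilde\nu)\to\infty$ as $\tilde\nu\to0$, such that $c\le\mu[\|u(e)-u(0)\|^2]\le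 C$ for all $(\mu,\tilde\nu,L)\in\tilde{\mathcal M}$ with $(\tilde\nu,L)\in D$. **Proposition.** $\tilde{\mathcal P}^G_{NS}$ satisfies Condition A if and only if $\mathcal P^G_{NS}$ has a scaling law of K41 type. -/

import Mathlib

open MeasureTheory ProbabilityTheory Filter Topology
open scoped NNReal ENNReal BoundedContinuousFunction

noncomputable section

namespace StochNS

/-! ### Tori and fields -/

/-- The set `ℝ₊` of positive real numbers. -/
abbrev PosReal : Type := {x : ℝ // 0 < x}

instance instFactPos (L : PosReal) : Fact (0 < (L : ℝ)) := ⟨L.2⟩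

/-- The torus `[0,L]³` with periodic identification. -/
abbrev Torus (L : PosReal) : Type := Fin 3 → AddCircle (L : ℝ)

/-- Normalised Lebesgue measure `L⁻³ dx` on the torus. -/
def torusMeasure (L : PosReal) : Measure (Torus L) :=
  Measure.pi fun _ => AddCircle.haarAddCircle

instance instProbTorus (L : PosReal) : IsProbabilityMeasure (torusMeasure L) := by
  unfold torusMeasure; infer_instance

instance instHaarTorus (L : PosReal) : (torusMeasure L).IsAddHaarMeasure := by
  unfold torusMeasure; infer_instance

/-- Velocity vectors, with the Euclidean norm. -/
abbrev Vel : Type := EuclideanSpace ℝ (Fin 3)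

/-- Square integrable vector fields on the torus, with norm `|u|² = L⁻³ ∫ ‖u(x)‖² dx`. -/
abbrev L2 (L : PosReal) : Type := Lp Vel 2 (torusMeasure L)

instance instMeasurableL2 (L : PosReal) : MeasurableSpace (L2 L) := borel _

instance instBorelL2 (L : PosReal) : BorelSpace (L2 L) := ⟨rfl⟩

/-- Wave numbers are `k = (2π/L) m`, and are indexed by `m ∈ ℤ³`. -/
abbrev Mode : Type := Fin 3 → ℤ

/-- The wave vector `k = (2π/L) m`. -/
def waveVec (L : PosReal) (m : Mode) : Fin 3 → ℝ := fun j => 2 * Real.pi / L * m j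

/-- `|k|²` for the wave vector `k = (2π/L) m`. -/
def waveSq (L : PosReal) (m : Mode) : ℝ := ∑ j, waveVec L m j ^ 2

/-- The character `e^{i k·x}`, `k = (2π/L) m`. -/
def character (L : PosReal) (m : Mode) (x : Torus L) : ℂ := ∏ j, fourier (m j) (x j)

/-- The Fourier coefficient `û(k) = L⁻³ ∫ e^{i k·x} u(x) dx ∈ ℂ³`, so that
`u(x) = ∑ₖ û(k) e^{-i k·x}`. -/
def fourierCoeffVec {L : PosReal} (u : L2 L) (m : Mode) : Fin 3 → ℂ :=
  fun j => ∫ x, character L m x * ((u x j : ℝ) : ℂ) ∂torusMeasure L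

/-- The energy space `H_L`: square integrable fields with zero mean and zero distributional
divergence on the torus (the divergence being tested against all characters). -/
def H (L : PosReal) : Set (L2 L) :=
  {u | ∫ x, u x ∂torusMeasure L = 0 ∧
    ∀ m : Mode, ∑ j, (waveVec L m j : ℂ) * fourierCoeffVec u m j = 0}

/-- `∑ₖ |k|^{2s} ‖û(k)‖²`. For `s = 1` this is `L⁻³ ∫ ‖Du‖²`, for `s = 2` it is `L⁻³ ∫ ‖Δu‖²`;
it is infinite when `u` is not in the Sobolev space of order `s`. -/
def sobolevSq {L : PosReal} (s : ℕ) (u : L2 L) : ℝ≥0∞ :=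
  ∑' m : Mode, ENNReal.ofReal (waveSq L m ^ s * ∑ j, ‖fourierCoeffVec u m j‖ ^ 2)

/-- The domain `D(A_L)` of the Stokes operator, that is, the fields of `H_L` of class `H²`. -/
def domA (L : PosReal) : Set (H L) := {u | sobolevSq 2 (u : L2 L) < ∞}

/-! ### The class `𝒫_L` of measures -/

/-- The translated field `u(· - a)`. -/
def translate {L : PosReal} (a : Torus L) (u : L2 L) : L2 L :=
  Lp.compMeasurePreserving (fun x => x - a) (measurePreserving_sub_right (torusMeasure L) a) u

/-- The rotations of `ℝ³` that map the set of coordinate axes to itself: these are exactly the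
orthogonal matrices with integer entries and determinant `1`. -/
abbrev AxisRotation : Type := Matrix.specialOrthogonalGroup (Fin 3) ℤ

/-- The action of an axis rotation on the torus. -/
def rotTorus (L : PosReal) (R : Matrix (Fin 3) (Fin 3) ℤ) : Torus L →+ Torus L where
  toFun x := fun i => ∑ j, R i j • x j
  map_zero' := by ext i; simp
  map_add' x y := by ext i; simp [Finset.sum_add_distrib]

lemma rotTorus_comp (L : PosReal) (R S : Matrix (Fin 3) (Fin 3) ℤ) (x : Torus L) :
    rotTorus L R (rotTorus L S x) = rotTorus L (R * S) x := by
  ext i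
  simp only [rotTorus, AddMonoidHom.coe_mk, ZeroHom.coe_mk, Matrix.mul_apply, Finset.smul_sum,
    Finset.sum_smul, mul_smul]
  rw [Finset.sum_comm]

lemma rotTorus_one (L : PosReal) (x : Torus L) : rotTorus L 1 x = x := by
  ext i
  simp [rotTorus, Matrix.one_apply]

lemma rotTorus_measurePreserving (L : PosReal) (R : AxisRotation) :
    MeasurePreserving (rotTorus L R.1) (torusMeasure L) (torusMeasure L) := by
  refine AddMonoidHom.measurePreserving ?_ ?_ rfl
  · change Continuous fun x : Torus L => fun i => ∑ j, R.1 i j • x j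
    fun_prop
  · intro x
    refine ⟨rotTorus L R.1.transpose x, ?_⟩
    rw [rotTorus_comp]
    have h := (Matrix.mem_orthogonalGroup_iff (Fin 3) ℤ).1
      (Matrix.mem_specialOrthogonalGroup_iff.1 R.2).1
    have h' : R.1 * R.1.transpose = 1 := h
    rw [h', rotTorus_one]

/-- The field `u(R ·)`. -/
def rotArg {L : PosReal} (R : AxisRotation) (u : L2 L) : L2 L :=
  Lp.compMeasurePreserving (rotTorus L R.1) (rotTorus_measurePreserving L R) u

/-- The field `R u(·)`. -/
def rotVal {L : PosReal} (R : AxisRotation) (u : L2 L) : L2 L :=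
  (Matrix.toEuclideanCLM (n := Fin 3) (𝕜 := ℝ) (R.1.map (Int.cast : ℤ → ℝ))).compLp u

/-- The class `𝒫_L` of probability measures on `H_L` that are concentrated on `D(A_L)`, have a
finite second moment in `V_L`, are space homogeneous and are partially (discretely) isotropic.
The fields `u(R ·)` and `R u(·)` need not be divergence free, so their laws are compared
on `L²`. -/
structure IsRegularSymmetric {L : PosReal} (μ : ProbabilityMeasure (H L)) : Prop where
  domA : (μ : Measure (H L)) (domA L) = 1
  moment : ∫⁻ u : H L, sobolevSq 1 (u : L2 L) ∂(μ : Measure (H L)) < ∞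
  homogeneous : ∀ (a : Torus L) (f : L2 L →ᵇ ℝ),
    ∫ u : H L, f (translate a (u : L2 L)) ∂(μ : Measure (H L))
      = ∫ u : H L, f (u : L2 L) ∂(μ : Measure (H L))
  isotropic : ∀ (R : AxisRotation) (f : L2 L →ᵇ ℝ),
    ∫ u : H L, f (rotArg R (u : L2 L)) ∂(μ : Measure (H L))
      = ∫ u : H L, f (rotVal R (u : L2 L)) ∂(μ : Measure (H L))

/-! ### The noise -/

/-- Squared Hilbert--Schmidt norm `|σ|²` of a complex `3 × 3` matrix. -/
def matNormSq (M : Matrix (Fin 3) (Fin 3) ℂ) : ℝ := ∑ i, ∑ j, ‖M i j‖ ^ 2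

/-- The standing assumptions on the noise coefficients `σ_m`. The coefficient `σ_m` belongs
to the wave number `2πm` on the unit torus and to `2πm/L` on the torus of side `L`.
The value at `m = 0` is never used. -/
structure IsNoiseCoeff (σ : Mode → Matrix (Fin 3) (Fin 3) ℂ) : Prop where
  divFree : ∀ m ≠ 0, Matrix.vecMul (fun i => (m i : ℂ)) (σ m) = 0
  summable : Summable fun m : Mode => matNormSq (σ m)
  hermitian : ∀ m ≠ 0, (σ m).map (starRingEnd ℂ) = σ (-m)
  isotropic : ∀ m ≠ 0, ∀ R : AxisRotation, matNormSq (σ m) = matNormSq (σ (R.1.mulVec m))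
  summable_grad : Summable fun m : Mode => waveSq 1 m * matNormSq (σ m)

/-- Real part (`false`) or imaginary part (`true`) of a complex number. -/
def part (b : Bool) (z : ℂ) : ℝ := if b then z.im else z.re

/-- The driving family `(β_m)`: three-dimensional complex Brownian motions, normalised so that
`E |β_m^j(t)|² = t`, that satisfy the reality constraint `β_{-m} = conj β_m` and are independent
otherwise, that is, along every set of modes without opposite pairs. -/
structure IsDrivingFamily {Ω : Type} [MeasurableSpace Ω] (P : Measure Ω)
    (β : Mode → ℝ≥0 → Ω → Fin 3 → ℂ) : Prop where
  measurable : ∀ m t, Measurable (β m t)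
  reality : ∀ m t ω j, β (-m) t ω j = starRingEnd ℂ (β m t ω j)
  brownian : ∀ m ≠ 0, ∀ (j : Fin 3) (b : Bool),
    IsBrownianReal (fun t ω => Real.sqrt 2 * part b (β m t ω j)) P
  indep : ∀ S : Set Mode, (∀ m ∈ S, -m ∉ S) →
    iIndepFun (fun (i : S × Fin 3 × Bool) ω (t : ℝ≥0) => part i.2.2 (β i.1 t ω i.2.1)) P

/-! ### Galerkin approximations -/

/-- The modes `m` of the `n`-th Galerkin approximation: `0 < |m| ≤ n`, equivalently
`0 < |k| ≤ (2π/L) n`. -/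
def modes (n : ℕ) : Finset Mode :=
  (Fintype.piFinset fun _ => Finset.Icc (-(n : ℤ)) n).filter fun m =>
    0 < ∑ j, m j ^ 2 ∧ ∑ j, m j ^ 2 ≤ (n : ℤ) ^ 2

/-- Projection of `v ∈ ℂ³` onto the orthogonal complement of `m ≠ 0`. -/
def leray (m : Mode) (v : Fin 3 → ℂ) : Fin 3 → ℂ :=
  fun i => v i - (∑ j, (m j : ℂ) * v j) / (∑ j, (m j : ℂ) ^ 2) * (m i : ℂ)

/-- The Fourier coefficient at `m` of `(u · ∇)u`, for a field `u` with modes in `modes n`: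
`∑_{h + l = m} (-i k_l · û(h)) û(l)`. -/
def convection {L : PosReal} (n : ℕ) (u : L2 L) (m : Mode) : Fin 3 → ℂ :=
  ∑ h ∈ modes n, ∑ l ∈ modes n, if h + l = m then
    (-Complex.I * ∑ j, (waveVec L l j : ℂ) * fourierCoeffVec u h j) • fourierCoeffVec u l
  else 0

/-- The Fourier coefficient at `m` of the drift `ν A_L u + π⁽ⁿ⁾ B_L(u,u)`. -/
def drift {L : PosReal} (ν : PosReal) (n : ℕ) (u : L2 L) (m : Mode) : Fin 3 → ℂ :=
  ((ν : ℂ) * (waveSq L m : ℂ)) • fourierCoeffVec u m + leray m (convection n u m)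

/-- `u` solves, in integral form and mode by mode, the Galerkin equation
`du + [ν A_L u + π⁽ⁿ⁾ B_L(u,u)] dt = ∑_{m ∈ modes n} σ_m dβ_m e^{-i k·x}` in `H_L⁽ⁿ⁾`. -/
structure IsGalerkinSolution (σ : Mode → Matrix (Fin 3) (Fin 3) ℂ) {L : PosReal} (ν : PosReal)
    (n : ℕ) {Ω : Type} [MeasurableSpace Ω] (P : Measure Ω) (β : Mode → ℝ≥0 → Ω → Fin 3 → ℂ)
    (u : ℝ≥0 → Ω → H L) : Prop where
  measurable : ∀ t, Measurable (u t)
  continuous : ∀ᵐ ω ∂P, Continuous fun t => u t ω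
  galerkin : ∀ᵐ ω ∂P, ∀ t, ∀ m ∉ modes n, fourierCoeffVec (u t ω : L2 L) m = 0
  equation : ∀ᵐ ω ∂P, ∀ t : ℝ≥0, ∀ m ∈ modes n,
    fourierCoeffVec (u t ω : L2 L) m
        + ∫ s in (0 : ℝ)..t, drift ν n (u s.toNNReal ω : L2 L) m
      = fourierCoeffVec (u 0 ω : L2 L) m + (σ m).mulVec (β m t ω)

/-- `μ` is an invariant measure of the `n`-th Galerkin equation: the solution started from a
random initial condition of law `μ`, independent of the noise, has law `μ` at all times. -/
def IsGalerkinInvariant (σ : Mode → Matrix (Fin 3) (Fin 3) ℂ) {L : PosReal} (ν : PosReal)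
    (n : ℕ) (μ : ProbabilityMeasure (H L)) : Prop :=
  ∃ (Ω : Type) (_ : MeasurableSpace Ω) (P : Measure Ω) (_ : IsProbabilityMeasure P)
    (β : Mode → ℝ≥0 → Ω → Fin 3 → ℂ) (u : ℝ≥0 → Ω → H L),
    IsDrivingFamily P β ∧ IsGalerkinSolution σ ν n P β u ∧
    IndepFun (u 0) (fun ω m t => β m t ω) P ∧
    ∀ t, P.map (u t) = (μ : Measure (H L))

/-- The set `𝒮ⁿ` of the invariant measures in `𝒫_L` of the `n`-th Galerkin equation. -/
def galerkinStationary (σ : Mode → Matrix (Fin 3) (Fin 3) ℂ) (ν L : PosReal) (n : ℕ) :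
    Set (ProbabilityMeasure (H L)) :=
  {μ | IsRegularSymmetric μ ∧ IsGalerkinInvariant σ ν n μ}

/-- The set `𝒫_NS^G(ν, L)` of Galerkin-limit stationary measures: weak limits on `H_L` of
`μ_{k_j} ∈ 𝒮^{k_j}` with `k_j → ∞`. -/
def galerkinLimit (σ : Mode → Matrix (Fin 3) (Fin 3) ℂ) (ν L : PosReal) :
    Set (ProbabilityMeasure (H L)) :=
  {μ | ∃ (k : ℕ → ℕ) (m : ℕ → ProbabilityMeasure (H L)), Tendsto k atTop atTop ∧
    (∀ j, m j ∈ galerkinStationary σ ν L (k j)) ∧ Tendsto m atTop (𝓝 μ)}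

/-- Pairs `(μ, ν)`, where `μ` is a probability measure on fields on the unit torus. -/
abbrev Pair : Type := ProbabilityMeasure (H 1) × PosReal

/-- Triples `(μ, ν, L)`, where `μ` is a probability measure on fields on the torus of side `L`. -/
structure Triple : Type where
  /-- side of the torus -/
  L : PosReal
  /-- viscosity -/
  ν : PosReal
  /-- law of the field -/
  μ : ProbabilityMeasure (H L)

/-- All pairs `(μ, ν)` with `μ ∈ 𝒫_NS^G(ν) = 𝒫_NS^G(ν, 1)`. -/
def pairsNS (σ : Mode → Matrix (Fin 3) (Fin 3) ℂ) : Set Pair :=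
  {p | p.1 ∈ galerkinLimit σ p.2 1}

/-- All triples `(μ, ν, L)` with `μ ∈ 𝒫_NS^G(ν, L)`. -/
def triplesNS (σ : Mode → Matrix (Fin 3) (Fin 3) ℂ) : Set Triple :=
  {τ | τ.μ ∈ galerkinLimit σ τ.ν τ.L}

/-! ### Structure function, K41 and Condition A -/

open Classical in
/-- The value `u(x)` of the continuous representative of `u`, which exists on `D(A_L)`
(and `0` if there is none). -/
def evalAt {L : PosReal} (u : L2 L) (x : Torus L) : Vel :=
  if h : ∃ g : C(Torus L, Vel), u =ᵐ[torusMeasure L] g then h.choose x else 0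

/-- The point `r e_i` of the torus. -/
def axisPoint (L : PosReal) (i : Fin 3) (r : ℝ) : Torus L :=
  fun j => ((Pi.single i r : Fin 3 → ℝ) j : AddCircle (L : ℝ))

/-- The second order structure function `S₂^μ(r) = μ[‖u(r e_i) - u(0)‖²] ∈ [0, ∞]`. -/
def structureFun {L : PosReal} (i : Fin 3) (μ : ProbabilityMeasure (H L)) (r : ℝ) : ℝ≥0∞ :=
  ∫⁻ u : H L, ENNReal.ofReal
    (‖evalAt (u : L2 L) (axisPoint L i r) - evalAt (u : L2 L) 0‖ ^ 2) ∂(μ : Measure (H L))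

/-- Scaling law of K41 type for a set of pairs, with `e_i` as coordinate unit vector. A monotone
function `R₀` on `(0, ν₀]` with limit `+∞` at `0` is necessarily nonincreasing. -/
def IsK41 (i : Fin 3) (M : Set Pair) : Prop :=
  ∃ (ν₀ c C C₀ : ℝ) (R₀ : ℝ → ℝ), 0 < ν₀ ∧ 0 < c ∧ c < C ∧ 0 < C₀ ∧
    AntitoneOn R₀ (Set.Ioc 0 ν₀) ∧ (∀ ν ∈ Set.Ioc 0 ν₀, C₀ < R₀ ν) ∧
    Tendsto R₀ (𝓝[>] 0) atTop ∧
    ∀ p ∈ M, (p.2 : ℝ) ≤ ν₀ → ∀ r : ℝ,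
      C₀ * (p.2 : ℝ) ^ (3 / 4 : ℝ) < r → r < (p.2 : ℝ) ^ (3 / 4 : ℝ) * R₀ p.2 →
      ENNReal.ofReal (c * r ^ (2 / 3 : ℝ)) ≤ structureFun i p.1 r ∧
      structureFun i p.1 r ≤ ENNReal.ofReal (C * r ^ (2 / 3 : ℝ))

/-- Admissible regions of pairs `(ν, L)`. -/
def IsAdmissibleRegion (D : Set (PosReal × PosReal)) : Prop :=
  ∃ (ν₀ : ℝ) (R₀ : ℝ → ℝ), 0 < ν₀ ∧ StrictAntiOn R₀ (Set.Ioc 0 ν₀) ∧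
    (∀ ν ∈ Set.Ioc 0 ν₀, 1 ≤ R₀ ν) ∧ Tendsto R₀ (𝓝[>] 0) atTop ∧
    D = {q | (q.1 : ℝ) < ν₀ ∧ R₀ q.1 < (q.2 : ℝ)}

/-- Condition A for a set of triples, with `e = e_i`. -/
def ConditionA (i : Fin 3) (M : Set Triple) : Prop :=
  ∃ (D : Set (PosReal × PosReal)) (c C : ℝ), IsAdmissibleRegion D ∧ 0 < c ∧ c < C ∧
    ∀ τ ∈ M, (τ.ν, τ.L) ∈ D →
      ENNReal.ofReal c ≤ structureFun i τ.μ 1 ∧ structureFun i τ.μ 1 ≤ ENNReal.ofReal C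

end StochNS

end

/-!
If `u` solves the Navier--Stokes equations with viscosity `ν` on the torus of side `L`, then
`v(x, t) = κ u(x / κ³, t / κ²)` solves them with viscosity `κ⁴ ν` on the torus of side `κ³ L`.
The Brownian scaling `κ β(t / κ²)` exactly absorbs the factor `κ`, so the noise coefficients do not
change, and all the other requirements on stationary Galerkin limits are invariant as well. As
`r^{-2/3} S₂(r)` is also invariant, Condition A at `(ν r^{-4/3}, L)` with `L = 1 / r` and separation
`1` is the K41 bound at `ν` on the unit torus with separation `r`.

It remains to compare the ranges of parameters. The functions `R₀` and `R̃₀` only encode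
uniformity: they exist if and only if, for some `ν₀` and every `ε > 0`, the bounds hold whenever the
invariant quantity `ν r^{-4/3}` lies in `[ε, ν₀)` and `L / r` is large enough.
-/

noncomputable section

namespace StochNS

/-! ### Bounds beyond a threshold -/

section Threshold

variable {ι : Type*} {x y : ι → ℝ} {p : ι → Prop} {x₀ : ℝ}

lemma exists_strictAntiOn_threshold (hx : ∀ a, 0 < x a)
    (h : ∀ ε > 0, ∃ Λ > 0, ∀ a, ε ≤ x a → x a < x₀ → Λ ≤ y a → p a) :
    ∃ R : ℝ → ℝ, StrictAntiOn R (Set.Ioc 0 x₀) ∧ (∀ t ∈ Set.Ioc 0 x₀, 1 ≤ R t) ∧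
      Tendsto R (𝓝[>] 0) atTop ∧ ∀ a, x a < x₀ → R (x a) < y a → p a := by
  let S (t : ℝ) : Set ℝ := {Λ | 0 ≤ Λ ∧ ∀ a, t ≤ x a → x a < x₀ → Λ < y a → p a}
  have hS_nonempty {t : ℝ} (ht : 0 < t) : (S t).Nonempty := by
    obtain ⟨Λ, hΛ, hp⟩ := h t ht
    exact ⟨Λ, hΛ.le, fun a hta ha hy => hp a hta ha hy.le⟩
  have hS_bdd (t : ℝ) : BddBelow (S t) := ⟨0, fun _ hΛ => hΛ.1⟩
  have hS_nonneg (t : ℝ) : 0 ≤ sInf (S t) := Real.sInf_nonneg fun _ hΛ => hΛ.1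
  have hS_anti {s t : ℝ} (hs : 0 < s) (hst : s ≤ t) : sInf (S t) ≤ sInf (S s) :=
    csInf_le_csInf (hS_bdd t) (hS_nonempty hs)
      fun Λ hΛ => ⟨hΛ.1, fun a hta => hΛ.2 a (hst.trans hta)⟩
  -- `sInf (S t)` itself may be constant in `t`; adding `t⁻¹` makes it strictly decreasing.
  refine ⟨fun t => sInf (S t) + 1 + t⁻¹, fun s hs t _ hst => ?_, fun t ht => ?_, ?_, ?_⟩
  · have := hS_anti hs.1 hst.le
    have := inv_strictAnti₀ hs.1 hst
    dsimp only
    linarith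
  · have := hS_nonneg t
    have := inv_pos.2 ht.1
    dsimp only
    linarith
  · refine tendsto_atTop_mono (fun t => ?_) tendsto_inv_nhdsGT_zero
    linarith [hS_nonneg t]
  · intro a ha hy
    have hlt : sInf (S (x a)) < y a := by linarith [inv_pos.2 (hx a)]
    obtain ⟨Λ, hΛ, hΛy⟩ := exists_lt_of_csInf_lt (hS_nonempty (hx a)) hlt
    exact hΛ.2 a le_rfl ha hΛy

lemma exists_strictAntiOn_threshold_iff (hx : ∀ a, 0 < x a) :
    (∃ R : ℝ → ℝ, StrictAntiOn R (Set.Ioc 0 x₀) ∧ (∀ t ∈ Set.Ioc 0 x₀, 1 ≤ R t) ∧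
        Tendsto R (𝓝[>] 0) atTop ∧ ∀ a, x a < x₀ → R (x a) < y a → p a) ↔
      ∀ ε > 0, ∃ Λ > 0, ∀ a, ε ≤ x a → x a < x₀ → Λ ≤ y a → p a := by
  refine ⟨?_, exists_strictAntiOn_threshold hx⟩
  rintro ⟨R, hR_anti, -, -, hR⟩ ε hε
  refine ⟨max 0 (R ε) + 1, by positivity, fun a hεa ha hy => hR a ha ?_⟩
  have hRa : R (x a) ≤ R ε := hR_anti.antitoneOn ⟨hε, hεa.trans ha.le⟩ ⟨hx a, ha.le⟩ hεa
  linarith [le_max_right 0 (R ε)]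

lemma exists_antitoneOn_threshold {C₀ : ℝ}
    (h : ∀ A > C₀, ∃ δ > 0, ∀ a, x a ≤ δ → C₀ < y a → y a ≤ A → p a) :
    ∃ (x₀ : ℝ) (R : ℝ → ℝ), 0 < x₀ ∧ AntitoneOn R (Set.Ioc 0 x₀) ∧
      (∀ t ∈ Set.Ioc 0 x₀, C₀ < R t) ∧ Tendsto R (𝓝[>] 0) atTop ∧
      ∀ a, x a ≤ x₀ → C₀ < y a → y a < R (x a) → p a := by
  -- The constraint `A ≤ t⁻¹` keeps `sSup (S t)` finite when the bounds hold for all `A`.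
  let S (t : ℝ) : Set ℝ := {A | A ≤ t⁻¹ ∧ ∀ a, x a ≤ t → C₀ < y a → y a ≤ A → p a}
  have hS_bdd (t : ℝ) : BddAbove (S t) := ⟨t⁻¹, fun _ hA => hA.1⟩
  have hS_nonempty (t : ℝ) : (S t).Nonempty :=
    ⟨min C₀ t⁻¹, min_le_right _ _, fun a _ hlt hle =>
      absurd (hlt.trans_le hle) (min_le_left _ _).not_gt⟩
  have hS_anti {s t : ℝ} (hs : 0 < s) (hst : s ≤ t) : S t ⊆ S s := fun A hA =>
    ⟨hA.1.trans (inv_anti₀ hs hst), fun a hxs => hA.2 a (hxs.trans hst)⟩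
  have hS_eventually (A : ℝ) (hA : C₀ < A) : ∃ δ > 0, ∀ t ∈ Set.Ioc 0 δ, A ∈ S t := by
    obtain ⟨δ, hδ, hp⟩ := h A hA
    have hη : 0 < (|A| + 1)⁻¹ := by positivity
    refine ⟨min δ (|A| + 1)⁻¹, lt_min hδ hη, fun t ht => ⟨?_, fun a hxt => hp a ?_⟩⟩
    · have := (le_inv_comm₀ ht.1 (by positivity)).1 (ht.2.trans (min_le_right _ _))
      linarith [le_abs_self A]
    · exact hxt.trans (ht.2.trans (min_le_left _ _))
  obtain ⟨x₀, hx₀, hmem⟩ := hS_eventually (C₀ + 1) (by linarith)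
  refine ⟨x₀, fun t => sSup (S t), hx₀, fun s hs t _ hst =>
    csSup_le_csSup (hS_bdd s) (hS_nonempty t) (hS_anti hs.1 hst), fun t ht => ?_, ?_, ?_⟩
  · exact (lt_add_one C₀).trans_le (le_csSup (hS_bdd t) (hmem t ht))
  · refine tendsto_atTop.2 fun A => ?_
    obtain ⟨δ, hδ, hδA⟩ := hS_eventually (max A (C₀ + 1)) (by simp)
    filter_upwards [Ioc_mem_nhdsGT hδ] with t ht
    exact (le_max_left _ _).trans (le_csSup (hS_bdd t) (hδA t ht))
  · intro a _ hCy hy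
    obtain ⟨A, hA, hyA⟩ := exists_lt_of_lt_csSup (hS_nonempty _) hy
    exact hA.2 a le_rfl hCy hyA.le

lemma exists_antitoneOn_threshold_iff {C₀ : ℝ} (hx : ∀ a, 0 < x a) :
    (∃ (x₀ : ℝ) (R : ℝ → ℝ), 0 < x₀ ∧ AntitoneOn R (Set.Ioc 0 x₀) ∧
        (∀ t ∈ Set.Ioc 0 x₀, C₀ < R t) ∧ Tendsto R (𝓝[>] 0) atTop ∧
        ∀ a, x a ≤ x₀ → C₀ < y a → y a < R (x a) → p a) ↔
      ∀ A > C₀, ∃ δ > 0, ∀ a, x a ≤ δ → C₀ < y a → y a ≤ A → p a := by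
  refine ⟨?_, exists_antitoneOn_threshold⟩
  rintro ⟨x₀, R, hx₀, -, -, hR_lim, hR⟩ A -
  have hlarge : ∀ᶠ t in 𝓝[>] (0 : ℝ), t ∈ Set.Ioc 0 x₀ ∧ A < R t :=
    .and (Ioc_mem_nhdsGT hx₀) (hR_lim.eventually_gt_atTop A)
  obtain ⟨δ, hδ, hδR⟩ := mem_nhdsGT_iff_exists_Ioc_subset.1 hlarge
  exact ⟨δ, hδ, fun a ha hCy hyA =>
    hR a (hδR ⟨hx a, ha⟩).1.2 hCy (hyA.trans_lt (hδR ⟨hx a, ha⟩).2)⟩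

end Threshold

/-! ### Dilations of the torus -/

section Dilation

variable (L L' : PosReal)

/-- The dilation `x ↦ (L' / L) x` between tori. -/
def dilation : Torus L ≃ₜ+ Torus L' where
  __ := Homeomorph.piCongrRight fun _ =>
    AddCircle.homeomorphAddCircle (L : ℝ) L' L.2.ne' L'.2.ne'
  map_add' x y := funext fun j => map_add (AddCircle.equivAddCircle (L : ℝ) L' _ _) (x j) (y j)

lemma dilation_apply (x : Torus L) (j : Fin 3) :
    dilation L L' x j = AddCircle.equivAddCircle (L : ℝ) L' L.2.ne' L'.2.ne' (x j) := rfl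

lemma dilation_dilation (x : Torus L) : dilation L' L (dilation L L' x) = x :=
  (dilation L L').symm_apply_apply x

lemma measurableEmbedding_dilation : MeasurableEmbedding (dilation L L') :=
  (dilation L L').toHomeomorph.measurableEmbedding

lemma measurePreserving_dilation :
    MeasurePreserving (dilation L L') (torusMeasure L) (torusMeasure L') :=
  AddMonoidHom.measurePreserving (f := (dilation L L' : Torus L →+ Torus L'))
    (dilation L L').continuous (dilation L L').surjective (by simp)

lemma dilation_rotTorus (R : Matrix (Fin 3) (Fin 3) ℤ) (x : Torus L) :
    dilation L L' (rotTorus L R x) = rotTorus L' R (dilation L L' x) := by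
  ext i
  simp [dilation_apply, rotTorus]

lemma character_dilation (m : Mode) (x : Torus L) :
    character L' m (dilation L L' x) = character L m x := by
  refine Finset.prod_congr rfl fun j _ => ?_
  obtain ⟨y, hy⟩ := QuotientAddGroup.mk_surjective (x j)
  rw [dilation_apply, ← hy, AddCircle.equivAddCircle_apply_mk, fourier_coe_apply,
    fourier_coe_apply]
  congr 1
  have hL : ((L : ℝ) : ℂ) ≠ 0 := by exact_mod_cast L.2.ne'
  have hL' : ((L' : ℝ) : ℂ) ≠ 0 := by exact_mod_cast L'.2.ne'
  push_cast
  field_simp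

lemma dilation_axisPoint (i : Fin 3) (r : ℝ) :
    dilation L L' (axisPoint L i r) = axisPoint L' i (L' / L * r) := by
  ext j
  rw [dilation_apply, axisPoint, AddCircle.equivAddCircle_apply_mk, axisPoint]
  congr 1
  obtain rfl | hj := eq_or_ne j i
  · simp only [Pi.single_eq_same]
    ring
  · simp [hj]

lemma waveVec_eq_mul (m : Mode) (j : Fin 3) : waveVec L' m j = L / L' * waveVec L m j := by
  have := L.2.ne'
  have := L'.2.ne'
  simp only [waveVec]
  field_simp

lemma waveSq_eq_mul (m : Mode) : waveSq L' m = (L / L' : ℝ) ^ 2 * waveSq L m := by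
  simp only [waveSq, Finset.mul_sum, waveVec_eq_mul L L', mul_pow]

end Dilation

/-! ### Rescaled fields -/

section ScaleField

variable (c : ℝ) (L L' : PosReal)

/-- The rescaling `u ↦ c u((L / L') ·)` of fields on the torus of side `L` to fields on the torus
of side `L'`. -/
def scaleField : L2 L →L[ℝ] L2 L' :=
  c • (Lp.compMeasurePreservingₗᵢ ℝ (dilation L' L)
    (measurePreserving_dilation L' L)).toContinuousLinearMap

lemma scaleField_apply (u : L2 L) :
    scaleField c L L' u =
      c • Lp.compMeasurePreserving (dilation L' L) (measurePreserving_dilation L' L) u := rfl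

lemma coeFn_scaleField (u : L2 L) :
    scaleField c L L' u =ᵐ[torusMeasure L'] fun x => c • u (dilation L' L x) := by
  rw [scaleField_apply]
  exact (Lp.coeFn_smul _ _).trans
    ((Lp.coeFn_compMeasurePreserving u (measurePreserving_dilation L' L)).const_smul c)

lemma scaleField_ae_eq {u : L2 L} {g : Torus L → Vel} (hg : u =ᵐ[torusMeasure L] g) :
    scaleField c L L' u =ᵐ[torusMeasure L'] fun x => c • g (dilation L' L x) :=
  (coeFn_scaleField c L L' u).trans
    (((measurePreserving_dilation L' L).quasiMeasurePreserving.ae_eq_comp hg).const_smul c)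

lemma scaleField_inv_scaleField {c : ℝ} (hc : c ≠ 0) (u : L2 L) :
    scaleField c⁻¹ L' L (scaleField c L L' u) = u := by
  refine Lp.ext ((scaleField_ae_eq c⁻¹ L' L (coeFn_scaleField c L L' u)).trans (.of_forall ?_))
  intro x
  simp only [dilation_dilation, inv_smul_smul₀ hc]

lemma fourierCoeffVec_scaleField (u : L2 L) (m : Mode) :
    fourierCoeffVec (scaleField c L L' u) m = (c : ℂ) • fourierCoeffVec u m := by
  ext j
  simp only [fourierCoeffVec, Pi.smul_apply, smul_eq_mul]
  rw [← integral_const_mul, ← (measurePreserving_dilation L' L).integral_comp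
    (measurableEmbedding_dilation L' L)]
  refine integral_congr_ae ?_
  filter_upwards [coeFn_scaleField c L L' u] with x hx
  rw [hx, character_dilation, PiLp.smul_apply, smul_eq_mul, Complex.ofReal_mul, mul_left_comm]

lemma integral_scaleField (u : L2 L) :
    ∫ x, scaleField c L L' u x ∂torusMeasure L' = c • ∫ x, u x ∂torusMeasure L := by
  rw [← integral_smul, ← (measurePreserving_dilation L' L).integral_comp
    (measurableEmbedding_dilation L' L)]
  exact integral_congr_ae (coeFn_scaleField c L L' u)

lemma sum_waveVec_mul_fourierCoeffVec_scaleField (u : L2 L) (l h : Mode) :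
    ∑ j, (waveVec L' l j : ℂ) * fourierCoeffVec (scaleField c L L' u) h j
      = ((L / L' * c : ℝ) : ℂ) * ∑ j, (waveVec L l j : ℂ) * fourierCoeffVec u h j := by
  rw [Finset.mul_sum]
  refine Finset.sum_congr rfl fun j _ => ?_
  rw [waveVec_eq_mul L L', fourierCoeffVec_scaleField, Pi.smul_apply, smul_eq_mul]
  push_cast
  ring

lemma scaleField_mem_H {u : L2 L} (hu : u ∈ H L) : scaleField c L L' u ∈ H L' := by
  refine ⟨by rw [integral_scaleField, hu.1, smul_zero], fun m => ?_⟩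
  rw [sum_waveVec_mul_fourierCoeffVec_scaleField, hu.2 m, mul_zero]

lemma sobolevSq_scaleField (s : ℕ) (u : L2 L) :
    sobolevSq s (scaleField c L L' u)
      = ENNReal.ofReal ((L / L' : ℝ) ^ (2 * s) * c ^ 2) * sobolevSq s u := by
  simp only [sobolevSq]
  rw [← ENNReal.tsum_mul_left]
  refine tsum_congr fun m => ?_
  rw [← ENNReal.ofReal_mul (by rw [pow_mul]; positivity), fourierCoeffVec_scaleField,
    waveSq_eq_mul L L']
  congr 1
  simp only [Pi.smul_apply, smul_eq_mul, norm_mul, mul_pow, Complex.norm_real, Real.norm_eq_abs,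
    sq_abs, ← Finset.mul_sum]
  ring

lemma sobolevSq_scaleField_lt_top_iff {c : ℝ} (hc : c ≠ 0) (s : ℕ) (u : L2 L) :
    sobolevSq s (scaleField c L L' u) < ∞ ↔ sobolevSq s u < ∞ := by
  have hLL' : (0 : ℝ) < L / L' := div_pos L.2 L'.2
  have hfactor : ENNReal.ofReal ((L / L' : ℝ) ^ (2 * s) * c ^ 2) ≠ 0 := by
    rw [ENNReal.ofReal_ne_zero_iff]
    positivity
  rw [sobolevSq_scaleField, lt_top_iff_ne_top, lt_top_iff_ne_top, ne_eq, ENNReal.mul_eq_top]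
  simp only [hfactor, ENNReal.ofReal_ne_top, ne_eq, not_false_eq_true, true_and, false_and,
    or_false]

lemma compMeasurePreserving_scaleField {f : Torus L → Torus L} {g : Torus L' → Torus L'}
    (hf : MeasurePreserving f (torusMeasure L) (torusMeasure L))
    (hg : MeasurePreserving g (torusMeasure L') (torusMeasure L'))
    (hfg : dilation L' L ∘ g = f ∘ dilation L' L) (u : L2 L) :
    Lp.compMeasurePreserving g hg (scaleField c L L' u)
      = scaleField c L L' (Lp.compMeasurePreserving f hf u) := by
  have hsmul (v : L2 L') : Lp.compMeasurePreserving g hg (c • v)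
      = c • Lp.compMeasurePreserving g hg v := (Lp.compMeasurePreservingₗ ℝ g hg).map_smul c v
  rw [scaleField_apply, scaleField_apply, hsmul, ← Lp.compMeasurePreserving_comp_apply,
    ← Lp.compMeasurePreserving_comp_apply]
  simp only [hfg]

lemma translate_scaleField (a : Torus L') (u : L2 L) :
    translate a (scaleField c L L' u) = scaleField c L L' (translate (dilation L' L a) u) :=
  compMeasurePreserving_scaleField c L L'
    (measurePreserving_sub_right (torusMeasure L) (dilation L' L a))
    (measurePreserving_sub_right (torusMeasure L') a)
    (funext fun x => map_sub (dilation L' L) x a) u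

lemma rotArg_scaleField (R : AxisRotation) (u : L2 L) :
    rotArg R (scaleField c L L' u) = scaleField c L L' (rotArg R u) :=
  compMeasurePreserving_scaleField c L L' (rotTorus_measurePreserving L R)
    (rotTorus_measurePreserving L' R) (funext (dilation_rotTorus L' L R.1)) u

lemma rotVal_scaleField (R : AxisRotation) (u : L2 L) :
    rotVal R (scaleField c L L' u) = scaleField c L L' (rotVal R u) := by
  refine Lp.ext ?_
  filter_upwards [ContinuousLinearMap.coeFn_compLp (Matrix.toEuclideanCLM (n := Fin 3) (𝕜 := ℝ)
      (R.1.map (Int.cast : ℤ → ℝ))) (scaleField c L L' u), coeFn_scaleField c L L' u,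
    scaleField_ae_eq c L L' (ContinuousLinearMap.coeFn_compLp
      (Matrix.toEuclideanCLM (n := Fin 3) (𝕜 := ℝ) (R.1.map (Int.cast : ℤ → ℝ))) u)]
    with x hrot hu hscale
  rw [rotVal, hrot, hu, rotVal, hscale, map_smul]

lemma evalAt_eq_of_ae_eq {L : PosReal} {u : L2 L} {g : C(Torus L, Vel)}
    (h : u =ᵐ[torusMeasure L] g) (x : Torus L) : evalAt u x = g x := by
  have hex : ∃ g : C(Torus L, Vel), u =ᵐ[torusMeasure L] g := ⟨g, h⟩
  rw [evalAt, dif_pos hex]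
  exact congrFun ((Continuous.ae_eq_iff_eq (torusMeasure L) hex.choose.continuous
    g.continuous).1 (hex.choose_spec.symm.trans h)) x

lemma exists_continuousMap_ae_eq_scaleField {u : L2 L}
    (hu : ∃ g : C(Torus L, Vel), u =ᵐ[torusMeasure L] g) :
    ∃ g : C(Torus L', Vel), scaleField c L L' u =ᵐ[torusMeasure L'] g := by
  obtain ⟨g, hg⟩ := hu
  exact ⟨⟨fun x => c • g (dilation L' L x), by fun_prop⟩, scaleField_ae_eq c L L' hg⟩

lemma evalAt_scaleField {c : ℝ} (hc : c ≠ 0) (u : L2 L) (x : Torus L') :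
    evalAt (scaleField c L L' u) x = c • evalAt u (dilation L' L x) := by
  by_cases hu : ∃ g : C(Torus L, Vel), u =ᵐ[torusMeasure L] g
  · obtain ⟨g, hg⟩ := hu
    let g' : C(Torus L', Vel) := ⟨fun x => c • g (dilation L' L x), by fun_prop⟩
    rw [evalAt_eq_of_ae_eq hg, evalAt_eq_of_ae_eq (g := g') (scaleField_ae_eq c L L' hg)]
    rfl
  · have hu' : ¬ ∃ g : C(Torus L', Vel), scaleField c L L' u =ᵐ[torusMeasure L'] g := fun h =>
      hu (scaleField_inv_scaleField L L' hc u ▸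
        exists_continuousMap_ae_eq_scaleField c⁻¹ L' L h)
    rw [evalAt, dif_neg hu', evalAt, dif_neg hu, smul_zero]

end ScaleField

/-! ### Rescaled laws -/

section ScaleLaw

variable {c : ℝ} (hc : c ≠ 0) (L L' : PosReal)

/-- The rescaling `scaleField` of fields, as a homeomorphism between energy spaces. -/
def scaleHomeo : H L ≃ₜ H L' where
  toFun u := ⟨scaleField c L L' u, scaleField_mem_H c L L' u.2⟩
  invFun u := ⟨scaleField c⁻¹ L' L u, scaleField_mem_H c⁻¹ L' L u.2⟩
  left_inv u := Subtype.ext (scaleField_inv_scaleField L L' hc u)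
  right_inv u := Subtype.ext (by
    simpa only [inv_inv] using scaleField_inv_scaleField L' L (inv_ne_zero hc) (u : L2 L'))

@[simp]
lemma coe_scaleHomeo (u : H L) : (scaleHomeo hc L L' u : L2 L') = scaleField c L L' u := rfl

/-- The law of the rescaled field `scaleField c L L' u`, for `u` of law `μ`. -/
def scaleLaw (μ : ProbabilityMeasure (H L)) : ProbabilityMeasure (H L') :=
  μ.map (scaleHomeo hc L L').continuous.aemeasurable

lemma toMeasure_scaleLaw (μ : ProbabilityMeasure (H L)) :
    (scaleLaw hc L L' μ : Measure (H L'))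
      = (μ : Measure (H L)).map (scaleHomeo hc L L').toMeasurableEquiv := rfl

lemma continuous_scaleLaw : Continuous (scaleLaw hc L L') :=
  ProbabilityMeasure.continuous_map (scaleHomeo hc L L').continuous

lemma IsRegularSymmetric.scaleLaw {L : PosReal} {μ : ProbabilityMeasure (H L)}
    (hμ : IsRegularSymmetric μ) : IsRegularSymmetric (scaleLaw hc L L' μ) where
  domA := by
    rw [toMeasure_scaleLaw, MeasurableEquiv.map_apply, ← hμ.domA]
    congr 1
    ext u
    exact sobolevSq_scaleField_lt_top_iff L L' hc 2 u
  moment := by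
    rw [toMeasure_scaleLaw, lintegral_map_equiv]
    simp only [Homeomorph.toMeasurableEquiv_coe, coe_scaleHomeo, sobolevSq_scaleField]
    rw [lintegral_const_mul' _ _ ENNReal.ofReal_ne_top]
    exact ENNReal.mul_lt_top ENNReal.ofReal_lt_top hμ.moment
  homogeneous a f := by
    rw [toMeasure_scaleLaw, integral_map_equiv, integral_map_equiv]
    simp only [Homeomorph.toMeasurableEquiv_coe, coe_scaleHomeo, translate_scaleField]
    exact hμ.homogeneous (dilation L' L a)
      (f.compContinuous ⟨scaleField c L L', (scaleField c L L').continuous⟩)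
  isotropic R f := by
    rw [toMeasure_scaleLaw, integral_map_equiv, integral_map_equiv]
    simp only [Homeomorph.toMeasurableEquiv_coe, coe_scaleHomeo, rotArg_scaleField,
      rotVal_scaleField]
    exact hμ.isotropic R
      (f.compContinuous ⟨scaleField c L L', (scaleField c L L').continuous⟩)

lemma structureFun_scaleLaw (i : Fin 3) (μ : ProbabilityMeasure (H L)) (r : ℝ) :
    structureFun i (scaleLaw hc L L' μ) (L' / L * r)
      = ENNReal.ofReal (c ^ 2) * structureFun i μ r := by
  simp only [structureFun]
  rw [toMeasure_scaleLaw, lintegral_map_equiv, ← lintegral_const_mul' _ _ ENNReal.ofReal_ne_top]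
  refine lintegral_congr fun u => ?_
  rw [Homeomorph.toMeasurableEquiv_coe, coe_scaleHomeo, evalAt_scaleField L L' hc,
    evalAt_scaleField L L' hc, ← dilation_axisPoint, dilation_dilation, map_zero, ← smul_sub,
    norm_smul, mul_pow, Real.norm_eq_abs, sq_abs, ENNReal.ofReal_mul (sq_nonneg c)]

end ScaleLaw

/-! ### Rescaled Galerkin equations -/

section Galerkin

lemma leray_smul (a : ℂ) (m : Mode) (v : Fin 3 → ℂ) : leray m (a • v) = a • leray m v := by
  ext i
  simp only [leray, Pi.smul_apply, smul_eq_mul, mul_left_comm _ a, ← Finset.mul_sum]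
  ring

lemma convection_scaleField (c : ℝ) (L L' : PosReal) (n : ℕ) (u : L2 L) (m : Mode) :
    convection n (scaleField c L L' u) m = ((c ^ 2 * (L / L') : ℝ) : ℂ) • convection n u m := by
  simp only [convection, Finset.smul_sum]
  refine Finset.sum_congr rfl fun h _ => Finset.sum_congr rfl fun l _ => ?_
  split_ifs
  · rw [sum_waveVec_mul_fourierCoeffVec_scaleField, fourierCoeffVec_scaleField, smul_smul,
      smul_smul]
    congr 1
    push_cast
    ring
  · rw [smul_zero]

variable {L L' ν ν' : PosReal}

lemma drift_scaleField {c : ℝ} (hc : c ≠ 0) (hL : (L' : ℝ) = c ^ 3 * L)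
    (hν : (ν' : ℝ) = c ^ 4 * ν) (n : ℕ) (u : L2 L) (m : Mode) :
    drift ν' n (scaleField c L L' u) m = c⁻¹ • drift ν n u m := by
  have hL0 := L.2.ne'
  have hconv : (c ^ 2 * (L / L') : ℝ) = c⁻¹ := by
    rw [hL]; field_simp
  have hstokes : (ν' * waveSq L' m * c : ℝ) = c⁻¹ * (ν * waveSq L m) := by
    rw [hν, waveSq_eq_mul L L', hL]; field_simp
  rw [drift, drift, convection_scaleField, leray_smul, fourierCoeffVec_scaleField, hconv, smul_smul,
    smul_add, ← Complex.coe_smul c⁻¹, ← Complex.coe_smul c⁻¹, smul_smul]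
  congr 2
  exact_mod_cast hstokes

lemma part_ofReal_mul (b : Bool) (a : ℝ) (z : ℂ) : part b (a * z) = a * part b z := by
  cases b <;> simp [part]

variable {Ω : Type} {c : ℝ≥0} {β : Mode → ℝ≥0 → Ω → Fin 3 → ℂ}

/-- The Brownian scaling `t ↦ c β(t / c²)` of a driving family. -/
def scaleNoise (c : ℝ≥0) (β : Mode → ℝ≥0 → Ω → Fin 3 → ℂ) :
    Mode → ℝ≥0 → Ω → Fin 3 → ℂ :=
  fun m t ω => ((c : ℝ) : ℂ) • β m ((c ^ 2)⁻¹ * t) ω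

lemma part_scaleNoise (b : Bool) (m : Mode) (t : ℝ≥0) (ω : Ω) (j : Fin 3) :
    part b (scaleNoise c β m t ω j) = c * part b (β m ((c ^ 2)⁻¹ * t) ω j) :=
  part_ofReal_mul b c _

variable [MeasurableSpace Ω] {P : Measure Ω} {σ : Mode → Matrix (Fin 3) (Fin 3) ℂ} {n : ℕ}

lemma IsDrivingFamily.scaleNoise (hβ : IsDrivingFamily P β) (hc : c ≠ 0) :
    IsDrivingFamily P (scaleNoise c β) where
  measurable m t := (hβ.measurable m ((c ^ 2)⁻¹ * t)).const_smul (c : ℂ)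
  reality m t ω j := by
    simp [StochNS.scaleNoise, hβ.reality]
  brownian m hm j b := by
    have hsqrt : (√(((c ^ 2)⁻¹ : ℝ≥0) : ℝ))⁻¹ = c := by
      rw [NNReal.coe_inv, Real.sqrt_inv, inv_inv, NNReal.coe_pow]
      exact Real.sqrt_sq c.coe_nonneg
    have hscaled := (hβ.brownian m hm j b).smul (c := (c ^ 2)⁻¹) (by positivity)
    rw [hsqrt] at hscaled
    convert hscaled using 3 with t ω
    rw [part_scaleNoise]
    ring
  indep S hS := by
    simp only [part_scaleNoise]
    exact (hβ.indep S hS).comp (fun _ f t => (c : ℝ) * f ((c ^ 2)⁻¹ * t)) fun _ => by fun_prop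

lemma integral_drift_scaleField (hc : c ≠ 0) (hL : (L' : ℝ) = (c : ℝ) ^ 3 * L)
    (hν : (ν' : ℝ) = (c : ℝ) ^ 4 * ν) (n : ℕ) (u : ℝ≥0 → L2 L) (m : Mode) (t : ℝ≥0) :
    ∫ s in (0 : ℝ)..t, drift ν' n (scaleField c L L' (u ((c ^ 2)⁻¹ * s.toNNReal))) m
      = (c : ℂ) • ∫ s in (0 : ℝ)..((c ^ 2)⁻¹ * t : ℝ≥0), drift ν n (u s.toNNReal) m := by
  have hc' : (c : ℝ) ≠ 0 := NNReal.coe_ne_zero.2 hc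
  have htime (s : ℝ) : (c ^ 2)⁻¹ * s.toNNReal = (((c : ℝ) ^ 2)⁻¹ * s).toNNReal := by
    rw [Real.toNNReal_mul (by positivity), Real.toNNReal_inv, Real.toNNReal_pow c.coe_nonneg,
      Real.toNNReal_coe]
  calc ∫ s in (0 : ℝ)..t, drift ν' n (scaleField c L L' (u ((c ^ 2)⁻¹ * s.toNNReal))) m
      = (c : ℝ)⁻¹ • ∫ s in (0 : ℝ)..t, drift ν n (u (((c : ℝ) ^ 2)⁻¹ * s).toNNReal) m := by
        simp only [drift_scaleField hc' hL hν, htime, intervalIntegral.integral_smul]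
    _ = (c : ℝ) • ((c : ℝ) ^ 2)⁻¹ •
          ∫ s in (0 : ℝ)..t, drift ν n (u (((c : ℝ) ^ 2)⁻¹ * s).toNNReal) m := by
        rw [smul_smul]
        congr 1
        field_simp
    _ = (c : ℂ) • ∫ s in (0 : ℝ)..((c ^ 2)⁻¹ * t : ℝ≥0), drift ν n (u s.toNNReal) m := by
        rw [intervalIntegral.smul_integral_comp_mul_left
          (fun s : ℝ => drift ν n (u s.toNNReal) m), mul_zero]
        push_cast
        rfl

lemma IsGalerkinSolution.scale {u : ℝ≥0 → Ω → H L} (hu : IsGalerkinSolution σ ν n P β u)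
    (hc : (c : ℝ) ≠ 0) (hL : (L' : ℝ) = (c : ℝ) ^ 3 * L) (hν : (ν' : ℝ) = (c : ℝ) ^ 4 * ν) :
    IsGalerkinSolution σ ν' n P (scaleNoise c β)
      fun t ω => scaleHomeo hc L L' (u ((c ^ 2)⁻¹ * t) ω) where
  measurable t := (scaleHomeo hc L L').continuous.measurable.comp (hu.measurable _)
  continuous := by
    filter_upwards [hu.continuous] with ω hω
    exact (scaleHomeo hc L L').continuous.comp (hω.comp (continuous_const_mul _))
  galerkin := by
    filter_upwards [hu.galerkin] with ω hω t m hm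
    rw [coe_scaleHomeo, fourierCoeffVec_scaleField, hω _ m hm, smul_zero]
  equation := by
    filter_upwards [hu.equation] with ω hω t m hm
    simp only [coe_scaleHomeo, mul_zero]
    rw [integral_drift_scaleField (NNReal.coe_ne_zero.1 hc) hL hν n (fun s => (u s ω : L2 L)),
      fourierCoeffVec_scaleField, fourierCoeffVec_scaleField, StochNS.scaleNoise,
      Matrix.mulVec_smul, ← smul_add, ← smul_add, hω _ m hm]

lemma IsGalerkinInvariant.scaleLaw {μ : ProbabilityMeasure (H L)}
    (hμ : IsGalerkinInvariant σ ν n μ) (hc : (c : ℝ) ≠ 0) (hL : (L' : ℝ) = (c : ℝ) ^ 3 * L)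
    (hν : (ν' : ℝ) = (c : ℝ) ^ 4 * ν) :
    IsGalerkinInvariant σ ν' n (scaleLaw hc L L' μ) := by
  obtain ⟨Ω, mΩ, P, hP, β, u, hβ, hu, hindep, hlaw⟩ := hμ
  refine ⟨Ω, mΩ, P, hP, StochNS.scaleNoise c β, _, hβ.scaleNoise (NNReal.coe_ne_zero.1 hc),
    hu.scale hc hL hν, ?_, fun t => ?_⟩
  · rw [mul_zero]
    exact hindep.comp (φ := scaleHomeo hc L L')
      (ψ := fun (f : Mode → ℝ≥0 → Fin 3 → ℂ) m t => ((c : ℝ) : ℂ) • f m ((c ^ 2)⁻¹ * t))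
      (scaleHomeo hc L L').continuous.measurable (by fun_prop)
  · rw [toMeasure_scaleLaw, ← hlaw ((c ^ 2)⁻¹ * t),
      Measure.map_map (MeasurableEquiv.measurable _) (hu.measurable _)]
    rfl

theorem scaleLaw_mem_galerkinLimit {μ : ProbabilityMeasure (H L)} (hμ : μ ∈ galerkinLimit σ ν L)
    (hc : (c : ℝ) ≠ 0) (hL : (L' : ℝ) = (c : ℝ) ^ 3 * L) (hν : (ν' : ℝ) = (c : ℝ) ^ 4 * ν) :
    scaleLaw hc L L' μ ∈ galerkinLimit σ ν' L' := by
  obtain ⟨k, m, hk, hm, hlim⟩ := hμ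
  exact ⟨k, fun j => scaleLaw hc L L' (m j), hk,
    fun j => ⟨(hm j).1.scaleLaw hc L', (hm j).2.scaleLaw hc hL hν⟩,
    ((continuous_scaleLaw hc L L').tendsto μ).comp hlim⟩

end Galerkin

/-! ### Scale invariance -/

section ScaleInvariance

/-- The two-sided K41 bounds `c r^{2/3} ≤ S₂^μ(r) ≤ C r^{2/3}` at a single separation `r`. -/
def K41Bounds {L : PosReal} (i : Fin 3) (c C : ℝ) (μ : ProbabilityMeasure (H L)) (r : ℝ) : Prop :=
  ENNReal.ofReal (c * r ^ (2 / 3 : ℝ)) ≤ structureFun i μ r ∧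
    structureFun i μ r ≤ ENNReal.ofReal (C * r ^ (2 / 3 : ℝ))

lemma k41Bounds_scaleLaw_iff {L L' : PosReal} {κ : ℝ} (hκ : 0 < κ) (hL : (L' : ℝ) = κ ^ 3 * L)
    (i : Fin 3) (c C : ℝ) (μ : ProbabilityMeasure (H L)) {r : ℝ} (hr : 0 ≤ r) :
    K41Bounds i c C (scaleLaw hκ.ne' L L' μ) (L' / L * r) ↔ K41Bounds i c C μ r := by
  have hpow : (L' / L * r : ℝ) ^ (2 / 3 : ℝ) = κ ^ 2 * r ^ (2 / 3 : ℝ) := by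
    rw [hL, mul_div_cancel_right₀ _ L.2.ne', Real.mul_rpow (by positivity) hr, ← Real.rpow_natCast,
      ← Real.rpow_mul hκ.le]
    norm_num
  have hκ2 : ENNReal.ofReal (κ ^ 2) ≠ 0 := ENNReal.ofReal_ne_zero_iff.2 (by positivity)
  simp only [K41Bounds, structureFun_scaleLaw, hpow, mul_left_comm _ (κ ^ 2),
    ENNReal.ofReal_mul (sq_nonneg κ), ENNReal.mul_le_mul_iff_right hκ2 ENNReal.ofReal_ne_top]

namespace Triple

variable (L' : PosReal) (τ : Triple)

/-- The ratio `(L' / L)^{1/3}` by which velocities are multiplied in `Triple.rescale`. -/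
def velocityRatio : ℝ≥0 :=
  ⟨(L' / τ.L : ℝ) ^ (1 / 3 : ℝ), Real.rpow_nonneg (div_pos L'.2 τ.L.2).le _⟩

lemma velocityRatio_pos : (0 : ℝ) < velocityRatio L' τ :=
  Real.rpow_pos_of_pos (div_pos L'.2 τ.L.2) _

lemma velocityRatio_pow (k : ℕ) :
    (velocityRatio L' τ : ℝ) ^ k = (L' / τ.L : ℝ) ^ (k / 3 : ℝ) := by
  change ((L' / τ.L : ℝ) ^ (1 / 3 : ℝ)) ^ k = _
  rw [← Real.rpow_mul_natCast (div_pos L'.2 τ.L.2).le, one_div_mul_eq_div]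

lemma eq_velocityRatio_pow_mul : (L' : ℝ) = (velocityRatio L' τ : ℝ) ^ 3 * τ.L := by
  rw [velocityRatio_pow, Nat.cast_ofNat, div_self three_ne_zero, Real.rpow_one,
    div_mul_cancel₀ _ τ.L.2.ne']

/-- The triple on the torus of side `L'` obtained by the rescaling that leaves the noise
coefficients of the Navier--Stokes equations unchanged. -/
def rescale : Triple where
  L := L'
  ν := ⟨(L' / τ.L : ℝ) ^ (4 / 3 : ℝ) * τ.ν,
    mul_pos (Real.rpow_pos_of_pos (div_pos L'.2 τ.L.2) _) τ.ν.2⟩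
  μ := scaleLaw (velocityRatio_pos L' τ).ne' τ.L L' τ.μ

lemma coe_ν_rescale : ((τ.rescale L').ν : ℝ) = (L' / τ.L : ℝ) ^ (4 / 3 : ℝ) * τ.ν := rfl

lemma rescale_ν_div_rpow {r : ℝ} (hr : 0 ≤ r) :
    ((τ.rescale L').ν : ℝ) / (L' / τ.L * r : ℝ) ^ (4 / 3 : ℝ) = τ.ν / r ^ (4 / 3 : ℝ) := by
  have hLL : (0 : ℝ) < L' / τ.L := div_pos L'.2 τ.L.2
  rw [coe_ν_rescale, Real.mul_rpow hLL.le hr,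
    mul_div_mul_left _ _ (Real.rpow_pos_of_pos hLL _).ne']

lemma k41Bounds_rescale_iff (i : Fin 3) (c C : ℝ) {r : ℝ} (hr : 0 ≤ r) :
    K41Bounds i c C (τ.rescale L').μ (L' / τ.L * r) ↔ K41Bounds i c C τ.μ r :=
  k41Bounds_scaleLaw_iff (velocityRatio_pos L' τ) (eq_velocityRatio_pow_mul L' τ) i c C τ.μ hr

end Triple

/-- A set of triples `(μ, ν, L)` is scale invariant if it is closed under rescaling to tori of
arbitrary side. -/
def IsScaleInvariant (M : Set Triple) : Prop :=
  ∀ L' : PosReal, ∀ τ ∈ M, τ.rescale L' ∈ M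

/-- The pairs `(μ, ν)` for which `(μ, ν, 1)` belongs to a given set of triples. -/
def unitSlice (M : Set Triple) : Set Pair :=
  {p | ⟨1, p.2, p.1⟩ ∈ M}

lemma IsScaleInvariant.forall_k41Bounds_one_iff {M : Set Triple} (hM : IsScaleInvariant M)
    (i : Fin 3) (c C : ℝ) (Q : ℝ → ℝ → Prop) :
    (∀ τ ∈ M, Q τ.ν τ.L → K41Bounds i c C τ.μ 1) ↔
      ∀ p ∈ unitSlice M, ∀ r > 0, Q (p.2 / r ^ (4 / 3 : ℝ)) r⁻¹ → K41Bounds i c C p.1 r := by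
  constructor
  · intro h p hp r hr hQ
    let τ : Triple := ⟨1, p.2, p.1⟩
    let L' : PosReal := ⟨r⁻¹, inv_pos.2 hr⟩
    have hsep : (L' / τ.L * r : ℝ) = 1 := by simp [τ, L', hr.ne']
    have hν := τ.rescale_ν_div_rpow L' hr.le
    have hbounds := τ.k41Bounds_rescale_iff L' i c C hr.le
    rw [hsep, Real.one_rpow, div_one] at hν
    rw [hsep] at hbounds
    exact hbounds.1 (h _ (hM L' τ hp) (hν ▸ hQ))
  · intro h τ hτ hQ
    have hsep : ((1 : PosReal) / τ.L * 1 : ℝ) = (τ.L : ℝ)⁻¹ := by simp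
    have hν := τ.rescale_ν_div_rpow 1 zero_le_one
    have hbounds := τ.k41Bounds_rescale_iff 1 i c C zero_le_one
    rw [hsep, Real.one_rpow, div_one] at hν
    rw [hsep] at hbounds
    refine hbounds.1 (h ((τ.rescale 1).μ, (τ.rescale 1).ν) (hM 1 τ hτ) _ (inv_pos.2 τ.L.2) ?_)
    rwa [hν, inv_inv]

theorem isScaleInvariant_triplesNS (σ : Mode → Matrix (Fin 3) (Fin 3) ℂ) :
    IsScaleInvariant (triplesNS σ) := by
  intro L' τ hτ
  refine scaleLaw_mem_galerkinLimit hτ _ (Triple.eq_velocityRatio_pow_mul L' τ) ?_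
  rw [Triple.velocityRatio_pow, Triple.coe_ν_rescale, Nat.cast_ofNat]

end ScaleInvariance

/-! ### Uniform forms of Condition A and of the K41 law -/

section UniformForms

lemma conditionA_iff (i : Fin 3) (M : Set Triple) :
    ConditionA i M ↔ ∃ ν₀ c C : ℝ, 0 < ν₀ ∧ 0 < c ∧ c < C ∧ ∀ ε > 0, ∃ Λ > 0, ∀ τ ∈ M,
      ε ≤ (τ.ν : ℝ) ∧ (τ.ν : ℝ) < ν₀ ∧ Λ ≤ (τ.L : ℝ) → K41Bounds i c C τ.μ 1 := by
  have hthreshold (ν₀ c C : ℝ) := exists_strictAntiOn_threshold_iff (ι := M) (x₀ := ν₀)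
    (x := fun τ => τ.1.ν) (y := fun τ => τ.1.L) (p := fun τ => K41Bounds i c C τ.1.μ 1)
    fun τ => τ.1.ν.2
  simp only [Subtype.forall] at hthreshold
  simp only [and_imp, ← hthreshold]
  simp only [K41Bounds, Real.one_rpow, mul_one]
  constructor
  · rintro ⟨D, c, C, ⟨ν₀, R, hν₀, hR_anti, hR_one, hR_lim, rfl⟩, hc, hcC, h⟩
    exact ⟨ν₀, c, C, hν₀, hc, hcC, R, hR_anti, hR_one, hR_lim, fun τ hτ hν hL => h τ hτ ⟨hν, hL⟩⟩
  · rintro ⟨ν₀, c, C, hν₀, hc, hcC, R, hR_anti, hR_one, hR_lim, h⟩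
    exact ⟨_, c, C, ⟨ν₀, R, hν₀, hR_anti, hR_one, hR_lim, rfl⟩, hc, hcC,
      fun τ hτ hD => h τ hτ hD.1 hD.2⟩

lemma isK41_iff_forall_gt (i : Fin 3) (N : Set Pair) :
    IsK41 i N ↔ ∃ c C C₀ : ℝ, 0 < c ∧ c < C ∧ 0 < C₀ ∧ ∀ A > C₀, ∃ δ > 0, ∀ p ∈ N, ∀ r : ℝ,
      (p.2 : ℝ) ≤ δ → C₀ < r / (p.2 : ℝ) ^ (3 / 4 : ℝ) → r / (p.2 : ℝ) ^ (3 / 4 : ℝ) ≤ A →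
      K41Bounds i c C p.1 r := by
  have hthreshold (c C C₀ : ℝ) := exists_antitoneOn_threshold_iff (ι := N × ℝ) (C₀ := C₀)
    (x := fun a => a.1.1.2) (y := fun a => a.2 / (a.1.1.2 : ℝ) ^ (3 / 4 : ℝ))
    (p := fun a => K41Bounds i c C a.1.1.1 a.2) fun a => a.1.1.2.2
  simp only [Prod.forall (α := N), Subtype.forall (p := (· ∈ N))] at hthreshold
  have hpow (p : Pair) : (0 : ℝ) < (p.2 : ℝ) ^ (3 / 4 : ℝ) := Real.rpow_pos_of_pos p.2.2 _
  simp only [← hthreshold]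
  simp only [lt_div_iff₀ (hpow _), div_lt_iff₀' (hpow _)]
  constructor
  · rintro ⟨ν₀, c, C, C₀, R, hν₀, hc, hcC, hC₀, hR_anti, hR_gt, hR_lim, h⟩
    exact ⟨c, C, C₀, hc, hcC, hC₀, ν₀, R, hν₀, hR_anti, hR_gt, hR_lim,
      fun p hp r hν => h p hp hν r⟩
  · rintro ⟨c, C, C₀, hc, hcC, hC₀, ν₀, R, hν₀, hR_anti, hR_gt, hR_lim, h⟩
    exact ⟨ν₀, c, C, C₀, R, hν₀, hc, hcC, hC₀, hR_anti, hR_gt, hR_lim,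
      fun p hp hν r => h p hp r hν⟩

lemma div_rpow_three_quarters {ν r : ℝ} (hν : 0 < ν) (hr : 0 < r) :
    r / ν ^ (3 / 4 : ℝ) = (ν / r ^ (4 / 3 : ℝ)) ^ (-(4 / 3) : ℝ)⁻¹ := by
  rw [inv_neg, Real.rpow_neg (by positivity), Real.div_rpow hν.le (by positivity),
    Real.rpow_rpow_inv hr.le (by norm_num), inv_div, inv_div]

lemma isK41_iff (i : Fin 3) (N : Set Pair) :
    IsK41 i N ↔ ∃ ν₀ c C : ℝ, 0 < ν₀ ∧ 0 < c ∧ c < C ∧ ∀ ε > 0, ∃ Λ > 0, ∀ p ∈ N,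
      ∀ r > 0, ε ≤ (p.2 : ℝ) / r ^ (4 / 3 : ℝ) ∧ (p.2 : ℝ) / r ^ (4 / 3 : ℝ) < ν₀ ∧ Λ ≤ r⁻¹ →
      K41Bounds i c C p.1 r := by
  rw [isK41_iff_forall_gt]
  have hneg : (-(4 / 3) : ℝ) < 0 := by norm_num
  have hpos : (0 : ℝ) < 4 / 3 := by norm_num
  constructor
  · rintro ⟨c, C, C₀, hc, hcC, hC₀, h⟩
    refine ⟨C₀ ^ (-(4 / 3) : ℝ), c, C, by positivity, hc, hcC, fun ε hε => ?_⟩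
    obtain ⟨δ, hδ, hbounds⟩ := h (max (ε ^ (-(4 / 3) : ℝ)⁻¹) (C₀ + 1)) (by simp)
    refine ⟨((δ / C₀ ^ (-(4 / 3) : ℝ)) ^ (4 / 3 : ℝ)⁻¹)⁻¹, by positivity,
      fun p hp r hr ⟨hεν, hνν₀, hr_small⟩ => hbounds p hp r ?_ ?_ ?_⟩
    · rw [inv_le_inv₀ (by positivity) hr, Real.le_rpow_inv_iff_of_pos hr.le (by positivity) hpos,
        le_div_iff₀' (by positivity)] at hr_small
      exact ((div_lt_iff₀ (by positivity)).1 hνν₀).le.trans hr_small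
    · rwa [div_rpow_three_quarters p.2.2 hr,
        Real.lt_rpow_inv_iff_of_neg hC₀ (div_pos p.2.2 (by positivity)) hneg]
    · rw [div_rpow_three_quarters p.2.2 hr]
      exact le_max_of_le_left (Real.rpow_le_rpow_of_nonpos hε hεν (inv_nonpos.2 hneg.le))
  · rintro ⟨ν₀, c, C, hν₀, hc, hcC, h⟩
    refine ⟨c, C, ν₀ ^ (-(4 / 3) : ℝ)⁻¹, hc, hcC, by positivity, fun A hA => ?_⟩
    have hA_pos : 0 < A := lt_trans (by positivity) hA
    obtain ⟨Λ, hΛ, hbounds⟩ := h (A ^ (-(4 / 3) : ℝ)) (by positivity)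
    refine ⟨A ^ (-(4 / 3) : ℝ) * Λ⁻¹ ^ (4 / 3 : ℝ), by positivity, fun p hp r hνδ hC₀r hrA => ?_⟩
    have hr : 0 < r := (div_pos_iff_of_pos_right (Real.rpow_pos_of_pos p.2.2 _)).1
      (lt_trans (by positivity) hC₀r)
    have hw : 0 < (p.2 : ℝ) / r ^ (4 / 3 : ℝ) := div_pos p.2.2 (by positivity)
    rw [div_rpow_three_quarters p.2.2 hr] at hC₀r hrA
    have hAν := (Real.rpow_inv_le_iff_of_neg hw hA_pos hneg).1 hrA
    have hνν₀ := (Real.rpow_lt_rpow_iff_of_neg hν₀ hw (inv_lt_zero.2 hneg)).1 hC₀r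
    refine hbounds p hp r hr ⟨hAν, hνν₀, ?_⟩
    rw [le_inv_comm₀ hΛ hr, ← Real.rpow_le_rpow_iff hr.le (inv_pos.2 hΛ).le hpos]
    rw [le_div_iff₀ (by positivity)] at hAν
    exact le_of_mul_le_mul_left (hAν.trans hνδ) (by positivity)

end UniformForms

end StochNS

end

theorem mainTheorem2_general (M : Set StochNS.Triple) (hM : StochNS.IsScaleInvariant M)
    (i : Fin 3) : StochNS.ConditionA i M ↔ StochNS.IsK41 i (StochNS.unitSlice M) := by
  have hscale (ν₀ c C ε Λ : ℝ) :=
    hM.forall_k41Bounds_one_iff i c C fun ν L => ε ≤ ν ∧ ν < ν₀ ∧ Λ ≤ L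
  simp only [StochNS.conditionA_iff, StochNS.isK41_iff, hscale]

theorem mainTheorem2 (σ : StochNS.Mode → Matrix (Fin 3) (Fin 3) ℂ)
    (hσ : StochNS.IsNoiseCoeff σ) (i : Fin 3) :
    StochNS.ConditionA i (StochNS.triplesNS σ) ↔ StochNS.IsK41 i (StochNS.pairsNS σ) :=
  mainTheorem2_general _ (StochNS.isScaleInvariant_triplesNS σ) i
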